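/- **Notation.** Let $t$ be an integer. *Graphs.* For a map $f:S\to S$ of a finite set, $\mathcal G(f/S)$ is the directed graph with vertex set $S$ and edges $s\to f(s)$. $\bigoplus$ denotes the disjoint union of directed graphs, and $n\times H$ is the disjoint union of $n$ copies of $H$. Rooted trees are directed towards the root; $\bullet$ is the one-vertex tree, and for rooted trees $T_1,\dots,T_m$, $\langle T_1\oplus\cdots\oplus T_m\rangle$ is the rooted tree whose root has exactly $m$ children, which are the roots of copies of $T_1,\dots,T_m$ (with $\langle\emptyset\rangle=\bullet$). For $m\ge 1$, $\operatorname{Cyc}(m,T)$ is the directed graph consisting of a directed $m$-cycle (a loop if $m=1$) each of whose vertices is the root of a copy of the rooted tree $T$. *Elementary trees.* For a non-increasing sequence of positive integers $v=(v_1,\dots,v_D)$ with $D \geq 1$ put $T_v^0=\bullet$, $$T_v^{k}=\Big\langle v_k\times T_v^{k-1}\oplus\bigoplus_{i=1}^{k-1}(v_i-v_{i+1})\times T_v^{i-1}\Big\rangle\quad(1\le k<D),\qquad T_v=\Big\langle (v_D-1)\times T_v^{D-1}\oplus\bigoplus_{i=1}^{D-1}(v_i-v_{i+1})\times T_v^{i-1}\Big\rangle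 .$$ *Iterated gcd.* For $n\ge1$, $\gcd_t(n)=(1)$ if $\gcd(t,n)=1$; otherwise $\gcd_t(n)=(n_1,\dots,n_D)$, where $n_1=\gcd(t,n)$, $n_{i+1}=\gcd\big(t,\,n/(n_1\cdots n_i)\big)$ for $i\ge 1$, and $D$ is the least positive integer with $n_{D+1}=1$. The product of finitely many finite sequences is the coordinatewise product, the shorter sequences being extended by terms equal to $1$ (the empty product is the sequence $(1)$). **Proposition.** Let $G$ be a finite abelian group, written as $G\cong\mathcal C_{r_1}\times\cdots\times\mathcal C_{r_k}$ with $\mathcal C_{r_i}$ cyclic of order $r_i\ge 1$, and let $\varphi_t:G\to G$, $\varphi_t(g)=g^t$. For each $i$ let $\omega_i$ be the greatest divisor of $r_i$ that is relatively prime to $t$, and write $r_i=\nu_i\omega_i$. Put $\gcd_t(\nu)=\prod_{i=1}^k\gcd_t(\nu_i)$. For $d=(d_1,\dots,d_k)$ with $d_i\mid\omega_i$ for all $i$ (written $d\mid\omega$) put $\varphi(d)=\prod_{i=1}^k\varphi(d_i)$, with $\varphi$ Euler's function, and $\operatorname{ord}_d(t)=\operatorname{lcm}\{\operatorname{ord}_{d_i}(t):1\le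 i\le k\}$, where $\operatorname{ord}_{d_i}(t)$ is the multiplicative order of $t$ modulo $d_i$. Then $G$ has exactly $\prod_{i=1}^k\omega_i$ elements that are $\varphi_t$-periodic, each $\varphi(d)/\operatorname{ord}_d(t)$ with $d\mid\omega$ is an integer, and there is an isomorphism of directed graphs $$\mathcal G(\varphi_t/G)\;\cong\;\bigoplus_{d\mid\omega}\frac{\varphi(d)}{\operatorname{ord}_d(t)}\times\operatorname{Cyc}\big(\operatorname{ord}_d(t),\,T_{\gcd_t(\nu)}\big).$$ -/

import Mathlib

namespace PowerMap

/-- The functional graph of `f : S → S`: the edges are `s ⟶ f s`. -/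
def functionalGraph {S : Type*} (f : S → S) : Digraph S where
  Adj a b := f a = b

/-- Isomorphism of directed graphs. -/
def DigraphIso {V W : Type*} (G : Digraph V) (H : Digraph W) : Prop :=
  Nonempty (G.Adj ≃r H.Adj)

/-- The disjoint union `⨁ i, G i` of a family of directed graphs. -/
def disjointUnion {ι : Type*} {V : ι → Type*} (G : ∀ i, Digraph (V i)) :
    Digraph (Σ i, V i) where
  Adj a b := ∃ (i : ι) (v w : V i), a = ⟨i, v⟩ ∧ b = ⟨i, w⟩ ∧ (G i).Adj v w

/-- `n × G`: the disjoint union of `n` copies of `G`. -/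
def copies {V : Type*} (n : ℕ) (G : Digraph V) : Digraph (Σ _ : Fin n, V) :=
  disjointUnion fun _ => G

/-- A rooted tree, given by its parent map; by convention the root is its own parent
(this is not an edge of the tree, see `RootedTree.digraph`). -/
structure RootedTree where
  V : Type
  root : V
  parent : V → V
  parent_root : parent root = root
  exists_iterate_parent : ∀ v, ∃ n : ℕ, parent^[n] v = root

namespace RootedTree

/-- The directed graph of a rooted tree: the edges go from each non-root vertex to its parent. -/
def digraph (T : RootedTree) : Digraph T.V where
  Adj v w := v ≠ T.root ∧ T.parent v = w

/-- The one-vertex tree `•`. -/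
def single : RootedTree where
  V := Unit
  root := ()
  parent := id
  parent_root := rfl
  exists_iterate_parent := fun _ => ⟨0, rfl⟩

open Classical in
/-- The parent map of `⟨⨁ i, T i⟩`; the new root is `none`. -/
noncomputable def joinParent {ι : Type} (T : ι → RootedTree) :
    Option (Σ i, (T i).V) → Option (Σ i, (T i).V)
  | none => none
  | some ⟨i, v⟩ => if v = (T i).root then none else some ⟨i, (T i).parent v⟩

/-- `⟨⨁ i, T i⟩`: a new root whose children are the roots of the trees `T i`. -/
noncomputable def join {ι : Type} (T : ι → RootedTree) : RootedTree where
  V := Option (Σ i, (T i).V)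
  root := none
  parent := joinParent T
  parent_root := rfl
  exists_iterate_parent := by
    rintro (_ | ⟨i, v⟩)
    · exact ⟨0, rfl⟩
    · obtain ⟨n, hn⟩ := (T i).exists_iterate_parent v
      induction n generalizing v with
      | zero =>
        refine ⟨1, ?_⟩
        have hv : v = (T i).root := hn
        simp [joinParent, hv]
      | succ n ih =>
        by_cases hv : v = (T i).root
        · exact ⟨1, by simp [joinParent, hv]⟩
        · obtain ⟨m, hm⟩ := ih ((T i).parent v) hn
          refine ⟨m + 1, ?_⟩
          rw [Function.iterate_succ_apply]
          simpa [joinParent, hv] using hm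

end RootedTree

/-- `Cyc(m, T)` (for `m ≥ 1`): an `m`-cycle each of whose vertices `(i, root)` is the root of a
copy of `T`. -/
def Cyc (m : ℕ) (T : RootedTree) : Digraph (ZMod m × T.V) where
  Adj a b := (a.1 = b.1 ∧ T.digraph.Adj a.2 b.2) ∨
    (a.2 = T.root ∧ b.2 = T.root ∧ b.1 = a.1 + 1)

/-- The trees `T_v^k`. Here `v i` is the `(i+1)`-st term of the sequence, so that
`T_v^0 = •` and `T_v^(k+1) = ⟨v k × T_v^k ⊕ ⨁_{j < k} (v j - v (j+1)) × T_v^j⟩`. -/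
noncomputable def levelTree (v : ℕ → ℕ) : ℕ → RootedTree
  | 0 => RootedTree.single
  | k + 1 => RootedTree.join (ι := Fin (v k) ⊕ (Σ j : Fin k, Fin (v j - v (j + 1))))
      (Sum.elim (fun _ => levelTree v k) (fun p => levelTree v p.1))
termination_by k => k
decreasing_by
  · exact Nat.lt_succ_self k
  · exact Nat.lt_succ_of_lt p.1.isLt

/-- The elementary tree `T_v` of a non-increasing sequence of positive integers
`v = (v_1, …, v_d)`, where `T_v = ⟨(v_d - 1) × T_v^(d-1) ⊕ ⨁_{i < d} (v_i - v_{i+1}) × T_v^(i-1)⟩`.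
The empty sequence is treated as the sequence `(1)`: its tree is `•`. -/
noncomputable def elementaryTree (v : List ℕ) : RootedTree :=
  let s : ℕ → ℕ := fun i => v.getD i 1
  match v.length with
  | 0 => RootedTree.single
  | e + 1 => RootedTree.join (ι := Fin (s e - 1) ⊕ (Σ j : Fin e, Fin (s j - s (j + 1))))
      (Sum.elim (fun _ => levelTree s e) (fun p => levelTree s p.1))

/-- The terms of the iterated gcd: `iterGcdTerm t n i` is the `(i+1)`-st term,
`gcd (t, n / (product of the preceding terms))`. -/
def iterGcdTerm (t : ℤ) (n : ℕ) : ℕ → ℕ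
  | i => Int.gcd t ((n / ∏ j : Fin i, iterGcdTerm t n j.1 : ℕ) : ℤ)
termination_by i => i
decreasing_by exact j.isLt

open Classical in
/-- The iterated gcd `gcd_t(n) = (ν_1, …, ν_D)` of `n ≥ 1` relative to `t`: it is `(1)` if
`gcd(t, n) = 1`; otherwise `D` is the least positive integer such that `ν_{D+1} = 1`. -/
noncomputable def iterGcd (t : ℤ) (n : ℕ) : List ℕ :=
  if Int.gcd t n = 1 then [1]
  else (List.range (sInf {D : ℕ | 0 < D ∧ iterGcdTerm t n D = 1})).map (iterGcdTerm t n)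

/-- The coordinatewise product of finitely many sequences, the shorter ones being extended
by terms equal to `1`. -/
def seqProd {k : ℕ} (u : Fin k → List ℕ) : List ℕ :=
  (List.range (Finset.univ.sup fun j => (u j).length)).map fun i => ∏ j, (u j).getD i 1

/-- `φ(d) = ∏ φ(d_i)`. -/
def totientProd {k : ℕ} (d : Fin k → ℕ) : ℕ := ∏ i, Nat.totient (d i)

/-- `ord_d(t) = lcm (ord_{d_i}(t))`, where `ord_n(t)` is the multiplicative order of `t` mod `n`. -/
noncomputable def ordLcm {k : ℕ} (d : Fin k → ℕ) (t : ℤ) : ℕ :=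
  Finset.univ.lcm fun i => orderOf ((t : ℤ) : ZMod (d i))

end PowerMap

/-!
By the Chinese remainder theorem the power map is the product of multiplication by `t` on
`∏ i, ℤ/ν i`, where it is nilpotent, and on `∏ i, ℤ/ω i`, where it is bijective.

For a nilpotent endomorphism `f` of a finite group the fibres of `f` within the range of `f^[j]` are
cosets of `ker f ∩ range f^[j]`, so the functional graph is a tree rooted at `0` whose shape depends
only on the numbers `|ker f ∩ range f^[j]|`. These are multiplicative over products, and for
multiplication by `t` on a cyclic group of order `n` they are the terms of `gcd_t(n)`.

On the bijective part, an element whose components have orders `d` lies on a cycle of length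
`ord_d(t)`, and there are `φ(d)` such elements. Finally, the product of a tree map with a
permutation `σ` is `σ` with the tree hung on each of its points: twist the vertices at depth `n` by
`σ ^ n`.
-/

namespace PowerMap

open Function Set

/-! ### Conjugacy of self-maps -/

/-- Conjugacy of self-maps, that is, isomorphism of their functional graphs. Working with maps
rather than graphs makes the decomposition of a power map a chain of conjugacies. -/
def Conjugate {S S' : Type*} (f : S → S) (g : S' → S') : Prop :=
  ∃ E : S ≃ S', Semiconj E f g

namespace Conjugate

variable {S S' S'' : Type*} {f : S → S} {g : S' → S'} {h : S'' → S''}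

theorem refl (f : S → S) : Conjugate f f :=
  ⟨Equiv.refl S, fun _ => rfl⟩

theorem symm (hfg : Conjugate f g) : Conjugate g f := by
  obtain ⟨E, hE⟩ := hfg
  exact ⟨E.symm, hE.inverse_left E.left_inv E.right_inv⟩

theorem trans (hfg : Conjugate f g) (hgh : Conjugate g h) : Conjugate f h := by
  obtain ⟨E, hE⟩ := hfg
  obtain ⟨F, hF⟩ := hgh
  exact ⟨E.trans F, hF.comp_left hE⟩

theorem prodMap {R R' : Type*} {k : R → R} {l : R' → R'} (hfg : Conjugate f g)
    (hkl : Conjugate k l) : Conjugate (Prod.map f k) (Prod.map g l) := by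
  obtain ⟨E, hE⟩ := hfg
  obtain ⟨F, hF⟩ := hkl
  exact ⟨E.prodCongr F, fun x => Prod.ext (hE x.1) (hF x.2)⟩

theorem piMap {ι : Type*} {A B : ι → Type*} {f : ∀ i, A i → A i} {g : ∀ i, B i → B i}
    (hfg : ∀ i, Conjugate (f i) (g i)) : Conjugate (Pi.map f) (Pi.map g) := by
  choose E hE using hfg
  exact ⟨Equiv.piCongrRight E, fun x => funext fun i => hE i (x i)⟩

theorem piMap_prodMap {ι : Type*} {A B : ι → Type*} (f : ∀ i, A i → A i) (g : ∀ i, B i → B i) :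
    Conjugate (Pi.map fun i => Prod.map (f i) (g i)) (Prod.map (Pi.map f) (Pi.map g)) :=
  ⟨Equiv.arrowProdEquivProdArrow _ _ _, fun _ => rfl⟩

theorem sigmaMap {ι : Type*} {A B : ι → Type*} {f : ∀ i, A i → A i} {g : ∀ i, B i → B i}
    (hfg : ∀ i, Conjugate (f i) (g i)) : Conjugate (Sigma.map id f) (Sigma.map id g) := by
  choose E hE using hfg
  exact ⟨Equiv.sigmaCongrRight E, fun x => congrArg (Sigma.mk x.1) (hE x.1 x.2)⟩

theorem natCard_eq (hfg : Conjugate f g) : Nat.card S = Nat.card S' :=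
  Nat.card_congr hfg.choose

theorem ncard_periodicPts_eq (hfg : Conjugate f g) :
    (periodicPts f).ncard = (periodicPts g).ncard := by
  obtain ⟨E, hE⟩ := hfg
  have hE' : Semiconj E.symm g f := hE.inverse_left E.left_inv E.right_inv
  have himage : E '' periodicPts f = periodicPts g :=
    hE.mapsTo_periodicPts.image_subset.antisymm
      fun y hy => ⟨E.symm y, hE'.mapsTo_periodicPts hy, E.apply_symm_apply y⟩
  rw [← himage, ncard_image_of_injective _ E.injective]

theorem digraphIso (hfg : Conjugate f g) :
    DigraphIso (functionalGraph f) (functionalGraph g) := by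
  obtain ⟨E, hE⟩ := hfg
  refine ⟨E, fun {a b} => ?_⟩
  change g (E a) = E b ↔ f a = b
  rw [← hE a, E.apply_eq_iff_eq]

theorem sigmaMap_fiber {D : Type*} (l : S → D) (hl : ∀ x, l (f x) = l x) :
    Conjugate f
      (Sigma.map id fun d => Subtype.map (p := fun x => l x = d) f fun _ => (hl _).trans) :=
  ⟨(Equiv.sigmaFiberEquiv l).symm, fun _ => (Equiv.symm_apply_eq _).2 rfl⟩

end Conjugate

theorem periodicPts_prodMap {R S : Type*} (f : R → R) (g : S → S) :
    periodicPts (Prod.map f g) = periodicPts f ×ˢ periodicPts g := by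
  ext x
  simp only [mem_prod, ← minimalPeriod_pos_iff_mem_periodicPts, minimalPeriod_prodMap,
    Nat.lcm_pos_iff]

theorem minimalPeriod_subtypeMap {S : Type*} {f : S → S} {p : S → Prop}
    (hp : ∀ x, p x → p (f x)) (x : Subtype p) :
    minimalPeriod (Subtype.map f hp) x = minimalPeriod f x := by
  refine minimalPeriod_eq_minimalPeriod_iff.2 fun n => ?_
  have hval : Semiconj Subtype.val (Subtype.map f hp) f := fun _ => rfl
  rw [IsPeriodicPt, IsPeriodicPt, IsFixedPt, IsFixedPt, Subtype.ext_iff, hval.iterate_right n x]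

theorem eq_of_mem_periodicPts_of_iterate_eq {S : Type*} {f : S → S} {x o : S} {n : ℕ}
    (ho : IsFixedPt f o) (hx : x ∈ periodicPts f) (hn : f^[n] x = o) : x = o := by
  obtain ⟨m, hm, hx⟩ := hx
  have hle : n ≤ m * n := Nat.le_mul_of_pos_left n hm
  rw [← (hx.mul_const n).eq, ← Nat.sub_add_cancel hle, iterate_add_apply, hn, (ho.iterate _).eq]

/-! ### Maps all of whose cycles have the same length -/

section UniformPeriod

variable {S : Type*} {f : S → S} {m : ℕ} [NeZero m]

theorem conjugate_prodMap_add_one (hf : ∀ x, minimalPeriod f x = m) :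
    Conjugate f (Prod.map id (· + 1) : range (periodicOrbit f) × ZMod m → _) := by
  have hper (x : S) : x ∈ periodicPts f :=
    minimalPeriod_pos_iff_mem_periodicPts.1 (hf x ▸ NeZero.pos m)
  have hmod (n : ℕ) (x : S) : f^[n % m] x = f^[n] x := by
    rw [← hf x, iterate_mod_minimalPeriod_eq]
  let base : range (periodicOrbit f) → S := rangeSplitting _
  have horbit (c) (n : ℕ) : periodicOrbit f (f^[n] (base c)) = c := by
    rw [periodicOrbit_apply_iterate_eq (hper _), apply_rangeSplitting (periodicOrbit f)]
  let ψ : range (periodicOrbit f) × ZMod m → S := fun p => f^[p.2.val] (base p.1)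
  have hψ : Bijective ψ := by
    constructor
    · rintro ⟨c, i⟩ ⟨c', j⟩ h
      obtain rfl : c = c' := Subtype.ext <| by
        rw [← horbit c i.val, ← horbit c' j.val]; exact congrArg _ h
      have hij : i.val = j.val := iterate_injOn_Iio_minimalPeriod (f := f) (x := base c)
        (mem_Iio.2 ((hf _).symm ▸ i.val_lt)) (mem_Iio.2 ((hf _).symm ▸ j.val_lt)) h
      rw [ZMod.val_injective m hij]
    · intro x
      obtain ⟨n, hn⟩ : ∃ n, f^[n] (base ⟨_, mem_range_self x⟩) = x := by
        rw [← mem_periodicOrbit_iff (hper _), apply_rangeSplitting (periodicOrbit f)]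
        exact self_mem_periodicOrbit (hper x)
      exact ⟨(⟨_, mem_range_self x⟩, n), by simp only [ψ, ZMod.val_natCast, hmod, hn]⟩
  refine Conjugate.symm ⟨Equiv.ofBijective ψ hψ, fun ⟨c, i⟩ => ?_⟩
  change f^[(i + 1).val] (base c) = f (f^[i.val] (base c))
  rw [← iterate_succ_apply' f, ZMod.val_add, hmod, ZMod.val_one_eq_one_mod,
    ← hmod (i.val + 1 % m), Nat.add_mod_mod, hmod]

theorem natCard_range_periodicOrbit_mul (hf : ∀ x, minimalPeriod f x = m) :
    Nat.card (range (periodicOrbit f)) * m = Nat.card S := by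
  rw [(conjugate_prodMap_add_one hf).natCard_eq, Nat.card_prod, Nat.card_zmod]

theorem dvd_natCard_of_minimalPeriod_eq (hf : ∀ x, minimalPeriod f x = m) : m ∣ Nat.card S :=
  ⟨_, (natCard_range_periodicOrbit_mul hf).symm.trans (mul_comm _ _)⟩

theorem conjugate_sigmaMap_add_one [Finite S] (hf : ∀ x, minimalPeriod f x = m) :
    Conjugate f
      (Sigma.map id fun _ => (· + 1) : (Σ _ : Fin (Nat.card S / m), ZMod m) → _) := by
  have hcard : Nat.card (range (periodicOrbit f)) = Nat.card S / m :=
    Nat.eq_div_of_mul_eq_left (NeZero.ne m) (natCard_range_periodicOrbit_mul hf)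
  refine (conjugate_prodMap_add_one hf).trans
    ⟨((Finite.equivFinOfCardEq hcard).prodCongr (Equiv.refl _)).trans
      (Equiv.sigmaEquivProd _ _).symm, fun _ => rfl⟩

end UniformPeriod

/-! ### Trees hung on the points of a map -/

namespace RootedTree

variable {P Q : Type*} (T : RootedTree)

open Classical in
/-- The self-map whose functional graph is that of `σ` with every point made the root of a copy
of `T`. -/
noncomputable def hang (σ : P → P) : P × T.V → P × T.V :=
  fun a => if a.2 = T.root then (σ a.1, T.root) else (a.1, T.parent a.2)

variable {T}

theorem hang_of_eq (σ : P → P) {a : P × T.V} (ha : a.2 = T.root) :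
    T.hang σ a = (σ a.1, T.root) :=
  if_pos ha

theorem hang_of_ne (σ : P → P) {a : P × T.V} (ha : a.2 ≠ T.root) :
    T.hang σ a = (a.1, T.parent a.2) :=
  if_neg ha

theorem periodicPts_parent : periodicPts T.parent = {T.root} := by
  have hroot : IsFixedPt T.parent T.root := T.parent_root
  refine Subset.antisymm (fun v hv => ?_)
    (singleton_subset_iff.2 (mk_mem_periodicPts one_pos (hroot.isPeriodicPt 1)))
  obtain ⟨n, hn⟩ := T.exists_iterate_parent v
  exact eq_of_mem_periodicPts_of_iterate_eq hroot hv hn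

theorem conjugate_hang {σ : P → P} {τ : Q → Q} (h : Conjugate σ τ) :
    Conjugate (T.hang σ) (T.hang τ) := by
  obtain ⟨E, hE⟩ := h
  refine ⟨E.prodCongr (Equiv.refl _), fun a => ?_⟩
  by_cases ha : a.2 = T.root
  · rw [hang_of_eq σ ha, hang_of_eq τ ha]
    exact Prod.ext (hE a.1) rfl
  · rw [hang_of_ne σ ha, hang_of_ne τ ha]
    rfl

theorem conjugate_hang_sigmaMap {ι : Type*} {A : ι → Type*} (σ : ∀ i, A i → A i) :
    Conjugate (T.hang (Sigma.map id σ)) (Sigma.map id fun i => T.hang (σ i)) := by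
  refine ⟨Equiv.sigmaProdDistrib _ _, fun ⟨⟨i, x⟩, v⟩ => ?_⟩
  by_cases hv : v = T.root
  · rw [hang_of_eq _ hv]
    exact congrArg (Sigma.mk i) (hang_of_eq (σ i) (a := (x, v)) hv).symm
  · rw [hang_of_ne _ hv]
    exact congrArg (Sigma.mk i) (hang_of_ne (σ i) (a := (x, v)) hv).symm

open Classical in
/-- The distance of a vertex to the root. -/
noncomputable def depth (v : T.V) : ℕ := Nat.find (T.exists_iterate_parent v)

theorem depth_root : depth T.root = 0 := by
  classical
  exact (Nat.find_eq_zero _).2 rfl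

theorem depth_eq_depth_parent_add_one {v : T.V} (hv : v ≠ T.root) :
    depth v = depth (T.parent v) + 1 := by
  classical
  exact Nat.find_comp_succ _ (T.exists_iterate_parent (T.parent v)) hv

theorem conjugate_prodMap_hang (σ : Equiv.Perm P) :
    Conjugate (Prod.map T.parent σ) (T.hang σ) := by
  -- Twisting by `σ ^ depth` replaces simultaneous motion in both coordinates by motion in the tree
  -- until the root is reached, and motion along `σ` from then on.
  refine ⟨(Equiv.prodShear (Equiv.refl T.V) fun v => σ ^ depth v).trans (Equiv.prodComm _ _),
    fun ⟨v, p⟩ => ?_⟩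
  change ((σ ^ depth (T.parent v)) (σ p), T.parent v) = T.hang σ ((σ ^ depth v) p, v)
  by_cases hv : v = T.root
  · subst hv
    rw [hang_of_eq σ rfl, T.parent_root, depth_root, pow_zero]
    rfl
  · rw [hang_of_ne σ hv, depth_eq_depth_parent_add_one hv, pow_succ]
    rfl

end RootedTree

theorem cyc_eq_functionalGraph (m : ℕ) (T : RootedTree) :
    Cyc m T = functionalGraph (T.hang fun i : ZMod m => i + 1) := by
  ext a b
  simp only [Cyc, RootedTree.digraph, functionalGraph]
  by_cases ha : a.2 = T.root
  · rw [RootedTree.hang_of_eq _ ha]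
    simp [ha, Prod.ext_iff, eq_comm, and_comm]
  · rw [RootedTree.hang_of_ne _ ha]
    simp [ha, Prod.ext_iff]

theorem disjointUnion_functionalGraph {ι : Type*} {A : ι → Type*} (f : ∀ i, A i → A i) :
    disjointUnion (fun i => functionalGraph (f i)) = functionalGraph (Sigma.map id f) := by
  ext a b
  constructor
  · rintro ⟨i, v, w, rfl, rfl, h⟩
    exact congrArg (Sigma.mk i) h
  · rintro rfl
    exact ⟨a.1, a.2, f a.1 a.2, rfl, rfl, rfl⟩

/-! ### Trees of iterated preimages -/

section Hanging

variable {S : Type*} {f : S → S} {x : S}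

/-- The iterated preimages of `x` under `f`, including `x` itself. -/
def backwardOrbit (f : S → S) (x : S) : Set S := {y | ∃ n, f^[n] y = x}

/-- The children of `x` in the functional graph of `f`: a loop at `x` does not count. -/
def children (f : S → S) (x : S) : Set S := {y | f y = x ∧ y ≠ x}

/-- The iterated preimages of `x` under `f` form a tree isomorphic to `T`; a loop at `x` is
ignored. -/
def HangsFrom (f : S → S) (x : S) (T : RootedTree) : Prop :=
  ∃ φ : T.V → S, Injective φ ∧ φ T.root = x ∧
    (∀ v, v ≠ T.root → f (φ v) = φ (T.parent v)) ∧ range φ = backwardOrbit f x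

/-- The trees hanging from the points of `s` are, up to order, the trees `T i`. -/
def ForestHangsFrom {ι : Type} (f : S → S) (s : Set S) (T : ι → RootedTree) : Prop :=
  ∃ c : ι → S, Injective c ∧ range c = s ∧ ∀ i, HangsFrom f (c i) (T i)

theorem backwardOrbit_eq_insert_iUnion (f : S → S) (x : S) :
    backwardOrbit f x = insert x (⋃ c ∈ children f x, backwardOrbit f c) := by
  ext y
  simp only [mem_insert_iff, mem_iUnion, exists_prop]
  constructor
  · rintro ⟨n, hn⟩
    induction n with
    | zero => exact Or.inl hn
    | succ n ih =>
      by_cases hx : f^[n] y = x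
      · exact ih hx
      · exact Or.inr ⟨f^[n] y, ⟨(iterate_succ_apply' f n y).symm.trans hn, hx⟩, n, rfl⟩
  · rintro (rfl | ⟨c, ⟨hc, -⟩, n, rfl⟩)
    · exact ⟨0, rfl⟩
    · exact ⟨n + 1, by rw [iterate_succ_apply', hc]⟩

theorem notMem_backwardOrbit_of_mem_children (hx : x ∈ periodicPts f → IsFixedPt f x) {c : S}
    (hc : c ∈ children f x) : x ∉ backwardOrbit f c := by
  rintro ⟨n, rfl⟩
  have hfix : IsFixedPt f x :=
    hx (mk_mem_periodicPts n.succ_pos ((iterate_succ_apply' f n x).trans hc.1))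
  exact hc.2 (hfix.iterate n)

theorem disjoint_backwardOrbit_of_mem_children (hx : x ∈ periodicPts f → IsFixedPt f x) {c d : S}
    (hc : c ∈ children f x) (hd : d ∈ children f x) (hcd : c ≠ d) :
    Disjoint (backwardOrbit f c) (backwardOrbit f d) := by
  rw [Set.disjoint_left]
  rintro y ⟨n, hn⟩ ⟨m, hm⟩
  wlog hnm : n < m generalizing c d n m
  · rcases (not_lt.1 hnm).lt_or_eq with hmn | rfl
    · exact this hd hc hcd.symm m hm n hn hmn
    · exact hcd (hn.symm.trans hm)
  obtain ⟨l, rfl⟩ := Nat.exists_eq_add_of_lt hnm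
  refine notMem_backwardOrbit_of_mem_children hx hd ⟨l, ?_⟩
  rw [← hc.1, ← hn, ← iterate_succ_apply' f n, ← iterate_add_apply, ← hm, Nat.add_succ,
    ← Nat.succ_add_eq_add_succ, add_comm n l]

namespace HangsFrom

theorem single (hx : backwardOrbit f x = {x}) : HangsFrom f x RootedTree.single :=
  ⟨fun _ => x, fun _ _ _ => rfl, rfl, fun v hv => absurd (Subsingleton.elim (α := Unit) v _) hv,
    (range_const (ι := Unit)).trans hx.symm⟩

theorem join (hx : x ∈ periodicPts f → IsFixedPt f x) {ι : Type} {T : ι → RootedTree}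
    (hT : ForestHangsFrom f (children f x) T) : HangsFrom f x (RootedTree.join T) := by
  obtain ⟨c, hc, hrange, hT⟩ := hT
  choose φ hinj hroot hparent hφ using hT
  have hchild (i) : c i ∈ children f x := hrange ▸ mem_range_self i
  have hmem (i v) : φ i v ∈ backwardOrbit f (c i) := hφ i ▸ mem_range_self v
  refine ⟨fun o => o.elim x fun p => φ p.1 p.2, ?_, rfl, ?_, ?_⟩
  · refine Option.injective_iff.2 ⟨?_, ?_⟩
    · rintro ⟨i, v⟩ ⟨j, w⟩ h
      obtain rfl : i = j := by
        by_contra hij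
        exact (disjoint_backwardOrbit_of_mem_children hx (hchild i) (hchild j)
          (hc.ne hij)).ne_of_mem (hmem i v) (hmem j w) h
      exact congrArg (Sigma.mk i) (hinj i h)
    · rintro ⟨⟨i, v⟩, h⟩
      exact notMem_backwardOrbit_of_mem_children hx (hchild i)
        ((show φ i v = x from h) ▸ hmem i v)
  · rintro (_ | ⟨i, v⟩) hv
    · exact absurd rfl hv
    · change f (φ i v) = Option.elim (RootedTree.joinParent T (some ⟨i, v⟩)) _ _
      by_cases h : v = (T i).root
      · simpa [RootedTree.joinParent, h, hroot] using (hchild i).1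
      · simpa [RootedTree.joinParent, h] using hparent i v h
  · rw [backwardOrbit_eq_insert_iUnion, ← hrange, biUnion_range]
    exact (Option.range_elim x _).trans <| congrArg (insert x) <|
      (range_sigma_eq_iUnion_range _).trans (iUnion_congr hφ)

theorem conjugate_parent {T : RootedTree} (hT : HangsFrom f x T) (hx : IsFixedPt f x)
    (hsurj : ∀ y, y ∈ backwardOrbit f x) : Conjugate f T.parent := by
  obtain ⟨φ, hinj, hroot, hparent, hφ⟩ := hT
  have hφ_surj : Surjective φ := range_eq_univ.1 (hφ.trans (eq_univ_of_forall hsurj))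
  refine Conjugate.symm ⟨Equiv.ofBijective φ ⟨hinj, hφ_surj⟩, fun v => ?_⟩
  change φ (T.parent v) = f (φ v)
  by_cases hv : v = T.root
  · rw [hv, T.parent_root, hroot, hx.eq]
  · exact (hparent v hv).symm

end HangsFrom

namespace ForestHangsFrom

theorem replicate {s : Set S} [Finite s] {m : ℕ} {T : RootedTree} (hm : s.ncard = m)
    (hT : ∀ y ∈ s, HangsFrom f y T) : ForestHangsFrom f s fun _ : Fin m => T := by
  let e : s ≃ Fin m := Finite.equivFinOfCardEq hm
  refine ⟨fun i => e.symm i, Subtype.val_injective.comp e.symm.injective, ?_,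
    fun i => hT _ (e.symm i).2⟩
  exact (e.symm.surjective.range_comp Subtype.val).trans Subtype.range_coe

theorem sum {ι κ : Type} {s u : Set S} {T : ι → RootedTree} {U : κ → RootedTree}
    (hsu : Disjoint s u) (hT : ForestHangsFrom f s T) (hU : ForestHangsFrom f u U) :
    ForestHangsFrom f (s ∪ u) (Sum.elim T U) := by
  obtain ⟨c, hc, rfl, hT⟩ := hT
  obtain ⟨d, hd, rfl, hU⟩ := hU
  exact ⟨Sum.elim c d,
    hc.sumElim hd fun i j => hsu.ne_of_mem (mem_range_self i) (mem_range_self j),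
    Sum.elim_range c d, Sum.rec hT hU⟩

theorem sigma {κ : Type} {ι : κ → Type} {s : κ → Set S} {T : ∀ k, ι k → RootedTree}
    (hs : Pairwise (Disjoint on s)) (hT : ∀ k, ForestHangsFrom f (s k) (T k)) :
    ForestHangsFrom f (⋃ k, s k) fun p : Σ k, ι k => T p.1 p.2 := by
  choose c hc hrange hT using hT
  refine ⟨fun p => c p.1 p.2, ?_, ?_, fun p => hT p.1 p.2⟩
  · rintro ⟨k, i⟩ ⟨l, j⟩ h
    obtain rfl : k = l := by
      by_contra hkl
      exact (hs hkl).ne_of_mem (hrange k ▸ mem_range_self i) (hrange l ▸ mem_range_self j) h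
    exact congrArg (Sigma.mk k) (hc k h)
  · simp only [range_sigma_eq_iUnion_range, hrange]

end ForestHangsFrom

end Hanging

/-! ### Trees of a locally nilpotent endomorphism -/

/-- The points of depth `j` in the image filtration of `f`: those in the image of `f^[j]` but not in
that of `f^[j + 1]`. -/
def imageLevel {S : Type*} (f : S → S) (j : ℕ) : Set S := range f^[j] \ range f^[j + 1]

/-- The number of elements of the kernel of `f` in the image of `f^[j]`. It is defined for bare
functions so that it makes sense for `Pi.map`. -/
noncomputable def kerRangeCard {N : Type*} [Zero N] (f : N → N) (j : ℕ) : ℕ :=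
  (f ⁻¹' {0} ∩ range f^[j]).ncard

section ImageLevel

variable {S : Type*} (f : S → S)

theorem antitone_range_iterate : Antitone fun j => range f^[j] :=
  antitone_nat_of_succ_le fun _ => range_comp_subset_range _ _

theorem pairwise_disjoint_imageLevel : Pairwise (Disjoint on imageLevel f) :=
  (pairwise_disjoint_on _).2 fun _ _ hij => Set.disjoint_left.2 fun _ hi hj =>
    hi.2 (antitone_range_iterate f (Nat.succ_le_of_lt hij) hj.1)

variable {f}

theorem exists_mem_imageLevel_of_notMem_range_iterate {k : ℕ} {y : S} (hy : y ∉ range f^[k]) :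
    ∃ j < k, y ∈ imageLevel f j := by
  induction k with
  | zero => exact absurd ⟨y, rfl⟩ hy
  | succ k ih =>
    by_cases hk : y ∈ range f^[k]
    · exact ⟨k, k.lt_succ_self, hk, hy⟩
    · obtain ⟨j, hj, hyj⟩ := ih hk
      exact ⟨j, hj.trans k.lt_succ_self, hyj⟩

theorem children_eq_union_iUnion {k : ℕ} {x : S} (hx : x ∈ range f^[k + 1]) :
    children f x =
      children f x ∩ range f^[k] ∪ ⋃ j : Fin k, f ⁻¹' {x} ∩ imageLevel f j := by
  ext y
  simp only [mem_union, mem_iUnion]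
  constructor
  · intro hy
    by_cases hk : y ∈ range f^[k]
    · exact Or.inl ⟨hy, hk⟩
    · obtain ⟨j, hj, hyj⟩ := exists_mem_imageLevel_of_notMem_range_iterate hk
      exact Or.inr ⟨⟨j, hj⟩, hy.1, hyj⟩
  · rintro (hy | ⟨j, hy, hyj⟩)
    · exact hy.1
    · refine ⟨hy, ?_⟩
      rintro rfl
      exact hyj.2 (antitone_range_iterate f (Nat.succ_le_succ j.2.le) hx)

end ImageLevel

section Endomorphism

variable {N : Type*} [AddGroup N] {f : N →+ N}

theorem ncard_fiber_inter_range_iterate {j : ℕ} {x : N} (hx : x ∈ range f^[j + 1]) :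
    (f ⁻¹' {x} ∩ range f^[j]).ncard = kerRangeCard f j := by
  obtain ⟨z, rfl⟩ := hx
  rw [iterate_succ_apply']
  have hcoset : f ⁻¹' {f (f^[j] z)} ∩ range f^[j] =
      (· + f^[j] z) '' (f ⁻¹' {0} ∩ range f^[j]) := by
    ext y
    constructor
    · rintro ⟨hy, w, rfl⟩
      refine ⟨f^[j] w - f^[j] z, ⟨?_, w - z, iterate_map_sub f j w z⟩, sub_add_cancel _ _⟩
      rw [mem_preimage, map_sub, mem_singleton_iff, sub_eq_zero]
      exact hy
    · rintro ⟨_, ⟨hy, w, rfl⟩, rfl⟩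
      refine ⟨?_, w + z, iterate_map_add f j w z⟩
      rw [mem_preimage, map_add, show f (f^[j] w) = 0 from hy, zero_add, mem_singleton_iff]
  rw [hcoset, ncard_image_of_injective _ (add_left_injective _), kerRangeCard]

theorem ncard_fiber_inter_imageLevel [Finite N] {j : ℕ} {x : N} (hx : x ∈ range f^[j + 2]) :
    (f ⁻¹' {x} ∩ imageLevel f j).ncard = kerRangeCard f j - kerRangeCard f (j + 1) := by
  have hanti : range f^[j + 1] ⊆ range f^[j] := antitone_range_iterate f j.le_succ
  rw [imageLevel, inter_sdiff_distrib_left, ncard_sdiff (inter_subset_inter_right _ hanti),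
    ncard_fiber_inter_range_iterate hx,
    ncard_fiber_inter_range_iterate (antitone_range_iterate f (j + 1).le_succ hx)]

theorem ncard_range_iterate_succ_mul [Finite N] (f : N →+ N) (j : ℕ) :
    (range f^[j + 1]).ncard * kerRangeCard f j = (range f^[j]).ncard := by
  classical
  have := Fintype.ofFinite N
  have hmaps : MapsTo f ((range f^[j]).toFinset) ((range f^[j + 1]).toFinset) := by
    simp only [coe_toFinset]
    rintro _ ⟨z, rfl⟩
    exact ⟨z, iterate_succ_apply' f j z⟩
  have hfiber : ∀ x ∈ (range f^[j + 1]).toFinset,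
      {y ∈ (range f^[j]).toFinset | f y = x}.card = kerRangeCard f j := by
    intro x hx
    rw [← ncard_fiber_inter_range_iterate (mem_toFinset.1 hx), ncard_eq_toFinset_card']
    congr 1
    ext y
    simp [and_comm]
  rw [ncard_eq_toFinset_card', ncard_eq_toFinset_card',
    Finset.card_eq_sum_card_fiberwise hmaps, Finset.sum_const_nat hfiber]

theorem ncard_range_iterate_mul_prod [Finite N] (f : N →+ N) (j : ℕ) :
    (range f^[j]).ncard * ∏ i : Fin j, kerRangeCard f i = Nat.card N := by
  induction j with
  | zero => rw [iterate_zero, range_id, ncard_univ, Fin.prod_univ_zero, mul_one]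
  | succ j ih =>
    rw [Fin.prod_univ_castSucc, mul_left_comm, Fin.val_last, ncard_range_iterate_succ_mul, mul_comm]
    exact ih

theorem eq_zero_of_mem_periodicPts (hnil : ∀ x, ∃ n, f^[n] x = 0) {x : N}
    (hx : x ∈ periodicPts f) : x = 0 :=
  eq_of_mem_periodicPts_of_iterate_eq (map_zero f) hx (hnil x).choose_spec

theorem isFixedPt_of_mem_periodicPts (hnil : ∀ x, ∃ n, f^[n] x = 0) {x : N}
    (hx : x ∈ periodicPts f) : IsFixedPt f x := by
  rw [eq_zero_of_mem_periodicPts hnil hx]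
  exact map_zero f

theorem iterate_eq_zero_of_kerRangeCard_eq_one [Finite N] (hnil : ∀ x, ∃ n, f^[n] x = 0) {k : ℕ}
    (hk : kerRangeCard f k = 1) (x : N) : f^[k] x = 0 := by
  obtain ⟨a, ha⟩ := ncard_eq_one.1 hk
  have hker {y : N} (hy : y ∈ range f^[k]) (hfy : f y = 0) : y = 0 := by
    have hmem {z : N} (hz : z ∈ range f^[k]) (hfz : f z = 0) : z = a :=
      mem_singleton_iff.1 (ha ▸ ⟨hfz, hz⟩)
    rw [hmem hy hfy, hmem ⟨0, iterate_map_zero f k⟩ (map_zero f)]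
  obtain ⟨n, hn⟩ := hnil (f^[k] x)
  induction n with
  | zero => exact hn
  | succ n ih =>
    refine ih (hker ⟨f^[n] x, ?_⟩ (by rwa [← iterate_succ_apply' f]))
    rw [← iterate_add_apply, ← iterate_add_apply, add_comm]

variable [Finite N]

theorem hangsFrom_join_levelTree (hnil : ∀ x, ∃ n, f^[n] x = 0) {k m : ℕ}
    (ih : ∀ j ≤ k, ∀ y ∈ imageLevel f j, HangsFrom f y (levelTree (kerRangeCard f) j))
    {x : N} (hx : x ∈ range f^[k + 1]) (hm : (children f x ∩ range f^[k]).ncard = m)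
    (htop : children f x ∩ range f^[k] ⊆ imageLevel f k) :
    HangsFrom f x (RootedTree.join
      (ι := Fin m ⊕ (Σ j : Fin k, Fin (kerRangeCard f j - kerRangeCard f (j + 1))))
      (Sum.elim (fun _ => levelTree (kerRangeCard f) k)
        fun p => levelTree (kerRangeCard f) p.1)) := by
  refine .join (fun hx => isFixedPt_of_mem_periodicPts hnil hx) ?_
  rw [children_eq_union_iUnion hx]
  have hlower (j : Fin k) : ForestHangsFrom f (f ⁻¹' {x} ∩ imageLevel f j)
      fun _ : Fin (kerRangeCard f j - kerRangeCard f (j + 1)) => levelTree (kerRangeCard f) j :=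
    .replicate (ncard_fiber_inter_imageLevel
      (antitone_range_iterate f (Nat.succ_le_succ (Nat.succ_le_of_lt j.2)) hx))
      fun y hy => ih j j.2.le y hy.2
  have hdisj : Pairwise (Disjoint on fun j : Fin k => f ⁻¹' {x} ∩ imageLevel f j) :=
    fun i j hij => (pairwise_disjoint_imageLevel f (Fin.val_injective.ne hij)).mono
      inter_subset_right inter_subset_right
  refine .sum ?_ (.replicate hm fun y hy => ih k le_rfl y (htop hy)) (.sigma hdisj hlower)
  exact disjoint_iUnion_right.2 fun j =>
    (pairwise_disjoint_imageLevel f j.2.ne').mono htop inter_subset_right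

theorem hangsFrom_levelTree (hnil : ∀ x, ∃ n, f^[n] x = 0) (k : ℕ) :
    ∀ x ∈ imageLevel f k, HangsFrom f x (levelTree (kerRangeCard f) k) := by
  induction k using Nat.strong_induction_on with
  | _ k ih =>
    rintro x ⟨hx, hx'⟩
    have hne {y : N} (hy : f y = x) : y ∉ range f^[k] := by
      rintro ⟨z, rfl⟩
      exact hx' ⟨z, (iterate_succ_apply' f k z).trans hy⟩
    cases k with
    | zero =>
      have hchildren : children f x = ∅ :=
        eq_empty_of_forall_notMem fun y hy => hne hy.1 ⟨y, rfl⟩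
      rw [levelTree]
      refine .single ?_
      rw [backwardOrbit_eq_insert_iUnion, hchildren, biUnion_empty, insert_empty_eq]
    | succ k =>
      have hchildren : children f x = f ⁻¹' {x} :=
        ext fun y => ⟨And.left, fun hy => ⟨hy, fun hyx => hne hy (hyx ▸ hx)⟩⟩
      rw [levelTree]
      refine hangsFrom_join_levelTree hnil (fun j hj => ih j (Nat.lt_succ_of_le hj)) hx ?_
        fun y hy => ⟨hy.2, hne hy.1.1⟩
      rw [hchildren, ncard_fiber_inter_range_iterate hx]

theorem hangsFrom_elementaryTree (hnil : ∀ x, ∃ n, f^[n] x = 0) {v : List ℕ}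
    (hv : ∀ j, v.getD j 1 = kerRangeCard f j) : HangsFrom f 0 (elementaryTree v) := by
  have hlength : ∀ x, f^[v.length] x = 0 :=
    iterate_eq_zero_of_kerRangeCard_eq_one hnil (by rw [← hv, List.getD_eq_default _ _ le_rfl])
  unfold elementaryTree
  rw [funext hv]
  cases hD : v.length with
  | zero =>
    rw [hD] at hlength
    exact .single (eq_singleton_iff_unique_mem.2 ⟨⟨0, rfl⟩, fun y _ => hlength y⟩)
  | succ e =>
    rw [hD] at hlength
    have hchildren : children f 0 ∩ range f^[e] = (f ⁻¹' {0} ∩ range f^[e]) \ {0} := by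
      rw [inter_sdiff_right_comm]
      rfl
    dsimp only
    have hzero : 0 ∈ f ⁻¹' {0} ∩ range f^[e] := ⟨map_zero f, 0, iterate_map_zero f e⟩
    refine hangsFrom_join_levelTree hnil (fun j _ => hangsFrom_levelTree hnil j)
      ⟨0, iterate_map_zero f _⟩ ?_ ?_
    · rw [hchildren, ncard_sdiff_singleton_of_mem hzero, kerRangeCard]
    · rintro y ⟨hy, hye⟩
      refine ⟨hye, ?_⟩
      rintro ⟨z, rfl⟩
      exact hy.2 (hlength z)

end Endomorphism

theorem kerRangeCard_piMap {ι : Type*} [Fintype ι] {A : ι → Type*} [∀ i, Zero (A i)]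
    (f : ∀ i, A i → A i) (j : ℕ) : kerRangeCard (Pi.map f) j = ∏ i, kerRangeCard (f i) j := by
  have hpi : Pi.map f ⁻¹' {0} ∩ range (Pi.map f)^[j] =
      univ.pi fun i => f i ⁻¹' {0} ∩ range (f i)^[j] := by
    rw [Pi.map_iterate, range_piMap, pi_inter_distrib, ← univ_pi_singleton]
    rfl
  simp only [kerRangeCard, hpi, ← Nat.card_coe_set_eq, ← Nat.card_pi]
  exact Nat.card_congr (Equiv.Set.univPi _)

/-! ### Iterated greatest common divisors -/

section IterGcd

variable (t : ℤ) {n : ℕ}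

theorem iterGcdTerm_zero (n : ℕ) : iterGcdTerm t n 0 = Int.gcd t n := by
  rw [iterGcdTerm, Finset.univ_eq_empty, Finset.prod_empty, Nat.div_one]

theorem iterGcdTerm_dvd_div (n j : ℕ) :
    iterGcdTerm t n j ∣ n / ∏ i : Fin j, iterGcdTerm t n i := by
  rw [iterGcdTerm]
  exact Int.natCast_dvd_natCast.1 (Int.gcd_dvd_right _ _)

theorem prod_iterGcdTerm_dvd (n j : ℕ) : ∏ i : Fin j, iterGcdTerm t n i ∣ n := by
  induction j with
  | zero => exact one_dvd n
  | succ j ih =>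
    rw [Fin.prod_univ_castSucc]
    exact Nat.mul_dvd_of_dvd_div ih (iterGcdTerm_dvd_div t n j)

theorem iterGcdTerm_succ_dvd (n j : ℕ) : iterGcdTerm t n (j + 1) ∣ iterGcdTerm t n j := by
  rw [iterGcdTerm, iterGcdTerm, Fin.prod_univ_castSucc, ← Nat.div_div_eq_div_mul]
  exact Int.gcd_dvd_gcd_of_dvd_right _
    (Int.natCast_dvd_natCast.2 (Nat.div_dvd_of_dvd (iterGcdTerm_dvd_div t n j)))

theorem iterGcdTerm_dvd_of_le {i j : ℕ} (hij : i ≤ j) :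
    iterGcdTerm t n j ∣ iterGcdTerm t n i := by
  induction j, hij using Nat.le_induction with
  | base => exact dvd_rfl
  | succ j _ ih => exact (iterGcdTerm_succ_dvd t n j).trans ih

variable {t}

theorem iterGcdTerm_eq_one_of_le {i j : ℕ} (hi : iterGcdTerm t n i = 1) (hij : i ≤ j) :
    iterGcdTerm t n j = 1 :=
  Nat.dvd_one.1 (hi ▸ iterGcdTerm_dvd_of_le t hij)

variable (t)

theorem iterGcdTerm_self (hn : n ≠ 0) : iterGcdTerm t n n = 1 := by
  by_contra hne
  have hprod := Nat.le_of_dvd (Nat.pos_of_ne_zero hn) (prod_iterGcdTerm_dvd t n n)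
  have htwo (i : Fin n) : 2 ≤ iterGcdTerm t n i := by
    have hzero : iterGcdTerm t n i ≠ 0 := fun h =>
      hn (zero_dvd_iff.1 (h ▸ (Finset.dvd_prod_of_mem _ (Finset.mem_univ i)).trans
        (prod_iterGcdTerm_dvd t n n)))
    have hone : iterGcdTerm t n i ≠ 1 := fun h => hne (iterGcdTerm_eq_one_of_le h i.2.le)
    omega
  have hpow : 2 ^ n ≤ ∏ i : Fin n, iterGcdTerm t n i := by
    simpa using Finset.prod_le_prod' fun i (_ : i ∈ Finset.univ) => htwo i
  exact (hpow.trans hprod).not_gt Nat.lt_two_pow_self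

theorem getD_iterGcd (hn : n ≠ 0) (j : ℕ) : (iterGcd t n).getD j 1 = iterGcdTerm t n j := by
  unfold iterGcd
  split_ifs with hgcd
  · rw [iterGcdTerm_eq_one_of_le ((iterGcdTerm_zero t n).trans hgcd) j.zero_le]
    cases j <;> simp
  · obtain ⟨-, hD⟩ := Nat.sInf_mem (s := {D | 0 < D ∧ iterGcdTerm t n D = 1})
      ⟨n, Nat.pos_of_ne_zero hn, iterGcdTerm_self t hn⟩
    set D := sInf {D | 0 < D ∧ iterGcdTerm t n D = 1}
    rcases lt_or_ge j D with hj | hj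
    · rw [List.getD_eq_getElem _ _ (by simpa using hj), List.getElem_map, List.getElem_range]
    · rw [List.getD_eq_default _ _ (by simpa using hj), iterGcdTerm_eq_one_of_le hD hj]

end IterGcd

theorem getD_seqProd {k : ℕ} (u : Fin k → List ℕ) (j : ℕ) :
    (seqProd u).getD j 1 = ∏ i, (u i).getD j 1 := by
  unfold seqProd
  rcases lt_or_ge j (Finset.univ.sup fun i => (u i).length) with hj | hj
  · rw [List.getD_eq_getElem _ _ (by simpa using hj), List.getElem_map, List.getElem_range]
  · rw [List.getD_eq_default _ _ (by simpa using hj)]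
    refine (Finset.prod_eq_one fun i _ => List.getD_eq_default _ _ ?_).symm
    exact (Finset.le_sup (f := fun i => (u i).length) (Finset.mem_univ i)).trans hj

section Cyclic

variable {A : Type*} [AddCommGroup A] [Finite A] [IsAddCyclic A]

theorem ncard_zsmul_preimage_zero_inter (t : ℤ) (H : AddSubgroup A) :
    ((t • · : A → A) ⁻¹' {0} ∩ H).ncard = Int.gcd t (Nat.card H) := by
  have hker : (t • · : A → A) ⁻¹' {0} ∩ H =
      Subtype.val '' ((nsmulAddMonoidHom t.natAbs : H →+ H).ker : Set H) := by
    ext a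
    simp [AddMonoidHom.mem_ker, and_comm, Subtype.ext_iff]
  rw [hker, ncard_image_of_injective _ Subtype.val_injective, ← Nat.card_coe_set_eq]
  exact (IsAddCyclic.card_nsmulAddMonoidHom_ker H t.natAbs).trans (Nat.gcd_comm _ _)

theorem kerRangeCard_zsmul (t : ℤ) (j : ℕ) :
    kerRangeCard (t • · : A → A) j = iterGcdTerm t (Nat.card A) j := by
  induction j using Nat.strong_induction_on with
  | _ j ih =>
    have hprod : (range (t • · : A → A)^[j]).ncard * ∏ i : Fin j, iterGcdTerm t (Nat.card A) i =
        Nat.card A := by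
      rw [Finset.prod_congr rfl fun (i : Fin j) _ => (ih i i.2).symm]
      exact ncard_range_iterate_mul_prod (zsmulAddGroupHom t : A →+ A) j
    have hpos : 0 < ∏ i : Fin j, iterGcdTerm t (Nat.card A) i :=
      Nat.pos_of_ne_zero fun h => Nat.card_pos.ne' (hprod.symm.trans (by rw [h, mul_zero]))
    rw [iterGcdTerm, Nat.div_eq_of_eq_mul_left hpos hprod.symm, kerRangeCard, smul_iterate]
    exact ncard_zsmul_preimage_zero_inter t (zsmulAddGroupHom (t ^ j) : A →+ A).range

end Cyclic

/-! ### Multiplication by an integer on products of cyclic groups -/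

theorem minimalPeriod_zsmul {A : Type*} [AddGroup A] (t : ℤ) (a : A) :
    minimalPeriod (t • ·) a = orderOf (t : ZMod (addOrderOf a)) := by
  refine Nat.dvd_right_iff_eq.1 fun n => ?_
  have hsub : (t ^ n - 1) • a = 0 ↔ t ^ n • a = a := by
    rw [sub_zsmul, one_zsmul, ← sub_eq_add_neg, sub_eq_zero]
  rw [← isPeriodicPt_iff_minimalPeriod_dvd, IsPeriodicPt, IsFixedPt, smul_iterate, ← hsub,
    ← addOrderOf_dvd_iff_zsmul_eq_zero, ← ZMod.intCast_zmod_eq_zero_iff_dvd, Int.cast_sub,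
    Int.cast_one, sub_eq_zero, Int.cast_pow, orderOf_dvd_iff_pow_eq_one]

theorem zsmul_injective_of_isCoprime {A : Type*} [AddCommGroup A] {t : ℤ}
    (h : IsCoprime t (Nat.card A)) : Injective (t • · : A → A) := by
  obtain ⟨u, v, huv⟩ := h
  refine (injective_iff_map_eq_zero (zsmulAddGroupHom t : A →+ A)).2 fun a ha => ?_
  change t • a = 0 at ha
  rw [← one_zsmul a, ← huv, add_zsmul, mul_zsmul,
    mul_zsmul, ha, natCast_zsmul, card_nsmul_eq_zero', smul_zero, smul_zero, add_zero]

theorem orderOf_intCast_pos {t : ℤ} {d : ℕ} [NeZero d] (h : IsCoprime t d) :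
    0 < orderOf (t : ZMod d) := by
  rw [← ZMod.coe_unitOfIsCoprime t h, orderOf_units]
  exact orderOf_pos _

section PiCyclic

variable {k : ℕ} {A : Fin k → Type*} [∀ i, AddCommGroup (A i)] {t : ℤ}

theorem minimalPeriod_piMap_zsmul (t : ℤ) (a : ∀ i, A i) :
    minimalPeriod (Pi.map fun i => (t • · : A i → A i)) a =
      ordLcm (fun i => addOrderOf (a i)) t := by
  simp only [minimalPeriod_piMap_fintype, minimalPeriod_zsmul, ordLcm]

theorem ordLcm_pos {d : Fin k → ℕ} (hd : ∀ i, d i ≠ 0) (h : ∀ i, IsCoprime t (d i)) :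
    0 < ordLcm d t := by
  have : ∀ i, NeZero (d i) := fun i => ⟨hd i⟩
  exact Nat.pos_of_ne_zero (Finset.lcm_ne_zero_iff.2 fun i _ => (orderOf_intCast_pos (h i)).ne')

/-- The orders of the components of an element of `∀ i, A i`; the sequences `d` that occur index
the cycles of multiplication by an integer prime to all these orders. -/
noncomputable def componentOrders (a : ∀ i, A i) : {d : Fin k → ℕ // ∀ i, d i ∣ Nat.card (A i)} :=
  ⟨fun i => addOrderOf (a i), fun i => addOrderOf_dvd_natCard (a i)⟩

theorem componentOrders_piMap_zsmul (h : ∀ i, IsCoprime t (Nat.card (A i))) (a : ∀ i, A i) :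
    componentOrders (Pi.map (fun i => (t • · : A i → A i)) a) = componentOrders a :=
  Subtype.ext <| funext fun i =>
    addOrderOf_injective (zsmulAddGroupHom t : A i →+ A i) (zsmul_injective_of_isCoprime (h i)) _

theorem minimalPeriod_componentOrders_fiber (h : ∀ i, IsCoprime t (Nat.card (A i)))
    (d : {d : Fin k → ℕ // ∀ i, d i ∣ Nat.card (A i)})
    (a : {a : ∀ i, A i // componentOrders a = d}) :
    minimalPeriod (Subtype.map (Pi.map fun i => (t • ·))
      fun b => (componentOrders_piMap_zsmul h b).trans) a = ordLcm d.1 t := by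
  rw [minimalPeriod_subtypeMap, minimalPeriod_piMap_zsmul]
  exact congrArg (fun d => ordLcm d.1 t) a.2

variable [∀ i, Finite (A i)]

theorem ordLcm_pos_of_dvd_natCard (h : ∀ i, IsCoprime t (Nat.card (A i)))
    (d : {d : Fin k → ℕ // ∀ i, d i ∣ Nat.card (A i)}) : 0 < ordLcm d.1 t :=
  ordLcm_pos (fun i => ne_zero_of_dvd_ne_zero Nat.card_pos.ne' (d.2 i))
    fun i => (h i).of_isCoprime_of_dvd_right (Int.natCast_dvd_natCast.2 (d.2 i))

variable [∀ i, IsAddCyclic (A i)]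

theorem conjugate_piMap_zsmul_parent {ν : Fin k → ℕ} (hA : ∀ i, Nat.card (A i) = ν i)
    (h : ∀ i, ∃ n : ℕ, (ν i : ℤ) ∣ t ^ n) :
    Conjugate (Pi.map fun i => (t • · : A i → A i))
      (elementaryTree (seqProd fun i => iterGcd t (ν i))).parent := by
  obtain rfl : (fun i => Nat.card (A i)) = ν := funext hA
  choose n hn using h
  have hnil (a : ∀ i, A i) : (t • ·)^[∑ i, n i] a = 0 := by
    ext i
    have hdvd : (Nat.card (A i) : ℤ) ∣ t ^ ∑ i, n i :=
      (hn i).trans (pow_dvd_pow t (Finset.single_le_sum_of_canonicallyOrdered (Finset.mem_univ i)))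
    rw [smul_iterate]
    change (t ^ ∑ i, n i) • a i = 0
    rw [← addOrderOf_dvd_iff_zsmul_eq_zero]
    exact (Int.natCast_dvd_natCast.2 (addOrderOf_dvd_natCard _)).trans hdvd
  have htree : HangsFrom (zsmulAddGroupHom t : (∀ i, A i) →+ _) 0
      (elementaryTree (seqProd fun i => iterGcd t (Nat.card (A i)))) := by
    refine hangsFrom_elementaryTree (fun a => ⟨_, hnil a⟩) fun j => ?_
    simp only [getD_seqProd, getD_iterGcd t Nat.card_pos.ne', ← kerRangeCard_zsmul]
    exact (kerRangeCard_piMap _ j).symm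
  exact htree.conjugate_parent (map_zero _) fun a => ⟨_, hnil a⟩

theorem natCard_componentOrders_fiber (d : {d : Fin k → ℕ // ∀ i, d i ∣ Nat.card (A i)}) :
    Nat.card {a : ∀ i, A i // componentOrders a = d} = totientProd d.1 := by
  classical
  have : ∀ i, Fintype (A i) := fun i => Fintype.ofFinite (A i)
  simp only [Subtype.ext_iff, funext_iff, componentOrders]
  rw [Nat.card_congr (Equiv.subtypePiEquivPi (p := fun i (x : A i) => addOrderOf x = d.1 i)),
    Nat.card_pi, totientProd]
  refine Finset.prod_congr rfl fun i _ => ?_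
  rw [Nat.card_eq_fintype_card, Fintype.card_subtype]
  exact IsAddCyclic.card_addOrderOf_eq_totient (Nat.card_eq_fintype_card (α := A i) ▸ d.2 i)

variable {ω : Fin k → ℕ} (hA : ∀ i, Nat.card (A i) = ω i) (h : ∀ i, IsCoprime t (ω i))

include hA h

theorem ordLcm_dvd_totientProd (d : {d : Fin k → ℕ // ∀ i, d i ∣ ω i}) :
    ordLcm d.1 t ∣ totientProd d.1 := by
  obtain rfl : (fun i => Nat.card (A i)) = ω := funext hA
  have : NeZero (ordLcm d.1 t) := ⟨(ordLcm_pos_of_dvd_natCard h d).ne'⟩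
  rw [← natCard_componentOrders_fiber d]
  exact dvd_natCard_of_minimalPeriod_eq (minimalPeriod_componentOrders_fiber h d)

theorem conjugate_piMap_zsmul_sigmaMap :
    Conjugate (Pi.map fun i => (t • · : A i → A i))
      (Sigma.map id fun d : {d : Fin k → ℕ // ∀ i, d i ∣ ω i} =>
        (Sigma.map id fun _ => (· + 1) :
          (Σ _ : Fin (totientProd d.1 / ordLcm d.1 t), ZMod (ordLcm d.1 t)) → _)) := by
  obtain rfl : (fun i => Nat.card (A i)) = ω := funext hA
  refine (Conjugate.sigmaMap_fiber componentOrders (componentOrders_piMap_zsmul h)).trans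
    (Conjugate.sigmaMap fun d => ?_)
  have : NeZero (ordLcm d.1 t) := ⟨(ordLcm_pos_of_dvd_natCard h d).ne'⟩
  have hfiber := conjugate_sigmaMap_add_one (minimalPeriod_componentOrders_fiber h d)
  rwa [natCard_componentOrders_fiber d] at hfiber

end PiCyclic

/-! ### Splitting a power map into a nilpotent and an invertible part -/

section Arithmetic

variable {t : ℤ} {ν ω : ℕ}

theorem prime_dvd_of_isGreatest (hω : IsGreatest {d : ℕ | d ∣ ν * ω ∧ IsCoprime t (d : ℤ)} ω)
    {p : ℕ} (hp : p.Prime) (hpν : p ∣ ν) : (p : ℤ) ∣ t := by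
  by_contra hpt
  have hcop : IsCoprime t ((p * ω : ℕ) : ℤ) := by
    rw [Nat.cast_mul]
    exact ((Nat.prime_iff_prime_int.1 hp).coprime_iff_not_dvd.2 hpt).symm.mul_right hω.1.2
  have hle : p * ω ≤ ω := hω.2 ⟨Nat.mul_dvd_mul_right hpν ω, hcop⟩
  have hpos : 0 < ω := hω.2 ⟨one_dvd _, Nat.cast_one (R := ℤ) ▸ isCoprime_one_right⟩
  exact hle.not_gt (lt_mul_of_one_lt_left hpos hp.one_lt)

theorem coprime_of_isGreatest (hω : IsGreatest {d : ℕ | d ∣ ν * ω ∧ IsCoprime t (d : ℤ)} ω) :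
    ν.Coprime ω :=
  Nat.coprime_of_dvd fun _ hp hpν hpω => (Nat.prime_iff_prime_int.1 hp).not_isUnit <|
    hω.1.2.isUnit_of_dvd' (prime_dvd_of_isGreatest hω hp hpν) (Int.natCast_dvd_natCast.2 hpω)

theorem dvd_pow_of_isGreatest (hν : ν ≠ 0)
    (hω : IsGreatest {d : ℕ | d ∣ ν * ω ∧ IsCoprime t (d : ℤ)} ω) : (ν : ℤ) ∣ t ^ ν := by
  rcases eq_or_ne t 0 with rfl | ht
  · rw [zero_pow hν]
    exact dvd_zero _
  · rw [Int.natCast_dvd, Int.natAbs_pow, Nat.dvd_pow_self_iff hν (Int.natAbs_ne_zero.2 ht)]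
    intro p hp
    have hp_prime := Nat.prime_of_mem_primeFactors hp
    exact Nat.mem_primeFactors.2 ⟨hp_prime, Int.natCast_dvd.1
      (prime_dvd_of_isGreatest hω hp_prime (Nat.dvd_of_mem_primeFactors hp)),
      Int.natAbs_ne_zero.2 ht⟩

end Arithmetic

theorem conjugate_zpow_prodMap_zsmul {C : Type*} [Group C] [IsCyclic C] {ν ω : ℕ}
    (hC : Nat.card C = ν * ω) (h : ν.Coprime ω) (t : ℤ) :
    Conjugate (fun c : C => c ^ t)
      (Prod.map (t • · : ZMod ν → ZMod ν) (t • · : ZMod ω → ZMod ω)) := by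
  let e : C ≃* Multiplicative (ZMod (ν * ω)) :=
    mulEquivOfCyclicCardEq (hC.trans (Nat.card_zmod _).symm)
  let e' : ZMod (ν * ω) ≃+ ZMod ν × ZMod ω := (ZMod.chineseRemainder h).toAddEquiv
  refine ⟨e.toEquiv.trans (Multiplicative.toAdd.trans e'.toEquiv), fun c => ?_⟩
  change e' (Multiplicative.toAdd (e (c ^ t))) = t • e' (Multiplicative.toAdd (e c))
  rw [map_zpow, toAdd_zpow, map_zsmul]

theorem conjugate_zpow_prodMap_piMap_zsmul {G : Type*} [Group G] {ι : Type*} {C : ι → Type*}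
    [∀ i, Group (C i)] [∀ i, IsCyclic (C i)] {ν ω : ι → ℕ}
    (hC : ∀ i, Nat.card (C i) = ν i * ω i) (h : ∀ i, (ν i).Coprime (ω i)) (e : G ≃* ∀ i, C i)
    (t : ℤ) :
    Conjugate (fun g : G => g ^ t)
      (Prod.map (Pi.map fun i => (t • · : ZMod (ν i) → ZMod (ν i)))
        (Pi.map fun i => (t • · : ZMod (ω i) → ZMod (ω i)))) := by
  have hG : Conjugate (fun g : G => g ^ t) (Pi.map fun i => (fun c : C i => c ^ t)) :=
    ⟨e.toEquiv, fun g => map_zpow e g t⟩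
  exact (hG.trans (.piMap fun i => conjugate_zpow_prodMap_zsmul (hC i) (h i) t)).trans
    (.piMap_prodMap _ _)

theorem ncard_periodicPts_prodMap_parent {P : Type*} [Finite P] {σ : P → P} (hσ : Injective σ)
    (T : RootedTree) : (periodicPts (Prod.map T.parent σ)).ncard = Nat.card P := by
  rw [periodicPts_prodMap, RootedTree.periodicPts_parent, eq_univ_of_forall hσ.mem_periodicPts,
    ncard_prod, ncard_singleton, one_mul, ncard_univ]

theorem disjointUnion_copies_cyc {ι : Type*} (n m : ι → ℕ) (T : RootedTree) :
    disjointUnion (fun i => copies (n i) (Cyc (m i) T)) =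
      functionalGraph (Sigma.map id fun i =>
        (Sigma.map id fun _ => T.hang (· + 1) : (Σ _ : Fin (n i), ZMod (m i) × T.V) → _)) := by
  simp only [copies, cyc_eq_functionalGraph, disjointUnion_functionalGraph]

theorem digraphIso_of_conjugate_prodMap_parent {S P ι : Type*} {f : S → S} {T : RootedTree}
    {σ : P → P} {n m : ι → ℕ} (hf : Conjugate f (Prod.map T.parent σ)) (hσ : Bijective σ)
    (hcycles : Conjugate σ (Sigma.map id fun i =>
      (Sigma.map id fun _ => (· + 1) : (Σ _ : Fin (n i), ZMod (m i)) → _))) :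
    DigraphIso (functionalGraph f) (disjointUnion fun i => copies (n i) (Cyc (m i) T)) := by
  rw [disjointUnion_copies_cyc]
  have hhang : Conjugate (Prod.map T.parent σ) (T.hang σ) :=
    RootedTree.conjugate_prodMap_hang (Equiv.ofBijective σ hσ)
  exact (((hf.trans hhang).trans (RootedTree.conjugate_hang hcycles)).trans
    ((RootedTree.conjugate_hang_sigmaMap _).trans
      (.sigmaMap fun _ => RootedTree.conjugate_hang_sigmaMap _))).digraphIso

end PowerMap

open PowerMap in
theorem mainTheorem3 {G : Type*} [CommGroup G] (t : ℤ) {k : ℕ}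
    (C : Fin k → Type*) [∀ i, Group (C i)] [∀ i, IsCyclic (C i)]
    (r ν ω : Fin k → ℕ) (hr : ∀ i, 0 < r i) (hC : ∀ i, Nat.card (C i) = r i)
    (e : G ≃* ((i : Fin k) → C i))
    (hω : ∀ i, IsGreatest {d : ℕ | d ∣ r i ∧ IsCoprime t (d : ℤ)} (ω i))
    (hν : ∀ i, r i = ν i * ω i) :
    (Function.periodicPts (fun g : G => g ^ t)).ncard = ∏ i, ω i ∧
    (∀ d : Fin k → ℕ, (∀ i, d i ∣ ω i) → ordLcm d t ∣ totientProd d) ∧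
    DigraphIso
      (functionalGraph (fun g : G => g ^ t))
      (disjointUnion fun d : {d : Fin k → ℕ // ∀ i, d i ∣ ω i} =>
        copies (totientProd d.1 / ordLcm d.1 t)
          (Cyc (ordLcm d.1 t) (elementaryTree (seqProd fun i => iterGcd t (ν i))))) := by
  obtain rfl : r = fun i => ν i * ω i := funext hν
  have hν_ne : ∀ i, NeZero (ν i) := fun i => ⟨left_ne_zero_of_mul (hr i).ne'⟩
  have hω_ne : ∀ i, NeZero (ω i) := fun i => ⟨right_ne_zero_of_mul (hr i).ne'⟩
  have hcop : ∀ i, IsCoprime t (ω i) := fun i => (hω i).1.2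
  have hcard : ∀ i, Nat.card (ZMod (ω i)) = ω i := fun i => Nat.card_zmod _
  have hbij : Function.Bijective (Pi.map fun i => (t • · : ZMod (ω i) → ZMod (ω i))) :=
    Finite.injective_iff_bijective.1 <| .piMap fun i =>
      zsmul_injective_of_isCoprime ((hcard i).symm ▸ hcop i)
  have hsplit := (conjugate_zpow_prodMap_piMap_zsmul hC (fun i => coprime_of_isGreatest (hω i)) e
    t).trans (.prodMap (conjugate_piMap_zsmul_parent (fun i => Nat.card_zmod _) fun i =>
      ⟨_, dvd_pow_of_isGreatest (NeZero.ne (ν i)) (hω i)⟩) (.refl _))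
  refine ⟨?_, fun d hd => ordLcm_dvd_totientProd hcard hcop ⟨d, hd⟩, ?_⟩
  · rw [hsplit.ncard_periodicPts_eq, ncard_periodicPts_prodMap_parent hbij.injective, Nat.card_pi]
    exact Finset.prod_congr rfl fun i _ => hcard i
  · exact digraphIso_of_conjugate_prodMap_parent hsplit hbij
      (conjugate_piMap_zsmul_sigmaMap hcard hcop)
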